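/- Let $p\ge 1$, let $\varepsilon_1,\varepsilon_2,\dots$ be i.i.d. $\mathcal N_p(0,I_p)$ random vectors, with coordinates $\varepsilon_t^i$, $1\le i\le p$, and consider the sequence without change $y_t=\varepsilon_t$. For $\tau<n$ define the evidence for a change after time $\tau$ in coordinate $i$ at time $n$ by $$E^i_{\tau,n}(0)=\frac1{\sqrt{n-\tau}}\sum_{t=\tau+1}^n y_t^i \quad (0\le\tau<n)$$ when the pre-change mean is known to be $0$, and by $$E^i_{\tau,n}(\cdot)=\sqrt{\frac{\tau(n-\tau)}{n}}\left(\frac1{n-\tau}\sum_{t=\tau+1}^n y_t^i-\frac1\tau\sum_{t=1}^{\tau} y_t^i\right)\quad (1\le\tau<n)$$ when it is unknown. In either scenario write $E^i_{\tau,n}$ for the evidence. Let $E^{(1)}_{\tau,n},\dots,E^{(p)}_{\tau,n}$ be the values $E^i_{\tau,n}$ sorted in decreasing order of $|E^i_{\tau,n}|$ and put $$S^s_{\tau,n}=\sum_{j=1}^s \big(E^{(j)}_{\tau,n}\big)^2\ (1\le s\le p),\qquad T^a_{\tau,n}=\sum_{i=1}^p \big(E^i_{\tau,n}\big)^2\mathbf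 1_{|E^i_{\tau,n}|\ge a}\ (a\ge 0).$$ For $0<\alpha<1$ let $x_n(\alpha)=4\log n-\log\alpha$. Then, both for the known and for the unknown pre-change mean, $$\mathbb P\big(\exists\,\tau<n:\ \tilde S_{\tau,n}\ge c_n(\alpha)\big)\le\alpha,$$ where $\tau,n$ range over all pairs of integers with $0\le\tau<n$ in the known and $1\le\tau<n$ in the unknown scenario, for each of the following choices of the statistic $\tilde S_{\tau,n}$ and of the threshold $c_n(\alpha)$: (1) $\tilde S_{\tau,n}=S^1_{\tau,n}$ and $c_n(\alpha)=2x_n(\alpha)+2\log(2p)$; (2) $\tilde S_{\tau,n}=S^s_{\tau,n}$ with any $1\le s\le p$, and $c_n(\alpha)=2\big(x_n(\alpha)+\log\binom ps\big)+2\sqrt{s\big(x_n(\alpha)+\log\binom ps\big)}+s$; (3) $\tilde S_{\tau,n}=T^a_{\tau,n}$ with any $a\ge0$, and $c_n(\alpha)=4x_n(\alpha)+6p\,e^{-a^2/8}$. Statements (1) and (2) also hold if the values $E^i_{\tau,n}$ are sorted in decreasing order of their signed values instead. -/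

import Mathlib

open MeasureTheory ProbabilityTheory

noncomputable section

namespace FalseAlarm

/-- Whether the pre-change mean is known (and then equal to `0`) or unknown. -/
inductive PreChangeMean
  | known
  | unknown

/-- The candidate changepoints at time `n`: all `τ < n`; when the pre-change mean is unknown there
has to be at least one observation before the change (the evidence below divides by `τ`). -/
def IsCandidate : PreChangeMean → ℕ → ℕ → Prop
  | .known, τ, n => τ < n
  | .unknown, τ, n => 1 ≤ τ ∧ τ < n

/-- The evidence, in coordinate `i`, for a change after time `τ` on the basis of the observations
`y 1, …, y n`. The value `y 0` is never used. -/
def evidence {p : ℕ} (y : ℕ → EuclideanSpace ℝ (Fin p)) (τ n : ℕ) :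
    PreChangeMean → Fin p → ℝ
  | .known, i => 1 / √((n : ℝ) - τ) * ∑ t ∈ Finset.Ioc τ n, y t i
  | .unknown, i => √((τ : ℝ) * ((n : ℝ) - τ) / n) *
      (1 / ((n : ℝ) - τ) * ∑ t ∈ Finset.Ioc τ n, y t i
        - 1 / (τ : ℝ) * ∑ t ∈ Finset.Ioc 0 τ, y t i)

/-- The quantity by which the coordinates are ranked: the absolute value of the evidence, or its
signed value. -/
inductive Ranking
  | magnitude
  | signed

/-- The score of an evidence value. -/
def Ranking.score : Ranking → ℝ → ℝ
  | .magnitude, x => |x|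
  | .signed, x => x

/-- The evidence vector sorted by decreasing score. -/
def sortedEvidence {p : ℕ} (r : Ranking) (e : Fin p → ℝ) (j : Fin p) : ℝ :=
  e (Tuple.sort (fun i => -r.score (e i)) j)

/-- The rank-`s` statistic: the sum of the squares of the first `s` sorted evidences
(positions are counted from `0`). -/
def rankStat {p : ℕ} (r : Ranking) (s : ℕ) (e : Fin p → ℝ) : ℝ :=
  ∑ j : Fin p with j.val < s, sortedEvidence r e j ^ 2

/-- The thresholded statistic. -/
def thresholdedStat {p : ℕ} (a : ℝ) (e : Fin p → ℝ) : ℝ :=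
  ∑ i : Fin p with a ≤ |e i|, e i ^ 2

/-- `x_n(α) = 4 log n - log α`. -/
def xn (α : ℝ) (n : ℕ) : ℝ := 4 * Real.log n - Real.log α

/-- The threshold `c_n(α)` for the rank-1 statistic. -/
def rankOneThreshold (p : ℕ) (α : ℝ) (n : ℕ) : ℝ :=
  2 * xn α n + 2 * Real.log (2 * p)

/-- The threshold `c_n(α)` for the rank-`s` statistic. -/
def rankThreshold (p s : ℕ) (α : ℝ) (n : ℕ) : ℝ :=
  2 * (xn α n + Real.log (p.choose s)) + 2 * √(s * (xn α n + Real.log (p.choose s))) + s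

/-- The threshold `c_n(α)` for the thresholded statistic. -/
def thresholdedThreshold (p : ℕ) (a α : ℝ) (n : ℕ) : ℝ :=
  4 * xn α n + 6 * p * Real.exp (-a ^ 2 / 8)

end FalseAlarm

end

namespace FalseAlarm

/-! For a fixed pair `(τ, n)`, the evidence vector is a linear combination of the observations with
squared weights summing to one, so it is standard Gaussian in both scenarios. The rest is a union
bound. There are at most `n` candidates at time `n`, and `exp (-x_n) = α / n ^ 4`, so a bound `C *
exp (-x_n)` for every pair gives `C * ζ(3) * α` in total. Since `ζ(3) > 1`, the constant `C = 1` of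
the usual tail bounds is not enough. As `ζ(3) ≤ 5/4`, the target is `C = 4/5`, and each tail
estimate is sharpened to reach it.

Rank statistics: however the coordinates are ordered, `S^s` is the sum of squares over some
`s`-subset. A union over the `p.choose s` subsets is paid for by the logarithm in the threshold,
leaving a chi-square tail (`stdGaussian_real_norm_sq_ge_le`). This tail is an integral in the radius
`r`, and `r² = s + √(2s) z + z²` compares it with a half-normal tail. The factor `1/2` from the
half-line and the Stirling constant `5/8` combine to `4/5`.

Thresholded statistic: an exponential moment at `1/4` factorizes over coordinates, and Markov's
inequality is applied to `exp (T / 4) - 1`. Subtracting one brings the constant down to `2/3`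
(`exp_sub_one_le_two_thirds`). -/

/-! ### Half-line Gaussian integrals and the radial substitution -/

theorem integrable_exp_neg_half_sq : Integrable (fun z : ℝ => Real.exp (-z ^ 2 / 2)) := by
  have h := integrable_exp_neg_mul_sq (b := 1 / 2) (by norm_num)
  refine h.congr (ae_of_all _ fun z => ?_)
  simp only
  congr 1
  ring

/-- Shift by `c` and drop the cross term: `(z + c)² ≥ z² + c²` for `z, c ≥ 0`. Keeping the half-line
mass `√(2π) / 2` saves a factor two, which the final constant needs. -/
theorem integral_Ioi_exp_neg_half_sq_le {c : ℝ} (hc : 0 ≤ c) :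
    ∫ z in Set.Ioi c, Real.exp (-z ^ 2 / 2) ≤ Real.exp (-c ^ 2 / 2) * (√(2 * Real.pi) / 2) := by
  have hshift : ∫ z in Set.Ioi c, Real.exp (-z ^ 2 / 2)
      = ∫ z in Set.Ioi (0 : ℝ), Real.exp (-(z + c) ^ 2 / 2) := by
    have h := integral_comp_mul_deriv_Ioi (f := fun z : ℝ => z + c) (f' := fun _ => 1)
      (g := fun z => Real.exp (-z ^ 2 / 2)) (a := 0) (by fun_prop)
      (Filter.tendsto_atTop_add_const_right _ _ Filter.tendsto_id)
      (fun x _ => ((hasDerivAt_id x).add_const c).hasDerivWithinAt) (by fun_prop)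
      integrable_exp_neg_half_sq.integrableOn
      (by simpa [Function.comp_def] using
        (integrable_exp_neg_half_sq.comp_add_right c).integrableOn)
    simpa using h.symm
  have hhalf : ∫ z in Set.Ioi (0 : ℝ), Real.exp (-z ^ 2 / 2) = √(2 * Real.pi) / 2 := by
    have h := integral_gaussian_Ioi (1 / 2)
    rw [show Real.pi / (1 / 2) = 2 * Real.pi by ring] at h
    rw [← h]
    congr 1
    ext z
    congr 1
    ring
  rw [hshift, ← hhalf, ← integral_const_mul]
  refine setIntegral_mono_on (integrable_exp_neg_half_sq.comp_add_right c).integrableOn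
    (integrable_exp_neg_half_sq.const_mul _).integrableOn measurableSet_Ioi fun z hz => ?_
  rw [← Real.exp_add, Real.exp_le_exp]
  nlinarith [mul_nonneg (le_of_lt (Set.mem_Ioi.1 hz)) hc]

theorem integrable_pow_mul_exp_neg_half_sq (n : ℕ) :
    Integrable (fun r : ℝ => r ^ n * Real.exp (-r ^ 2 / 2)) := by
  have h := integrable_rpow_mul_exp_neg_mul_sq (b := 1 / 2) (by norm_num) (s := n)
    (by have : (0 : ℝ) ≤ n := n.cast_nonneg
        linarith)
  refine h.congr (ae_of_all _ fun z => ?_)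
  simp only [Real.rpow_natCast]
  congr 2
  ring

/-- The radial chi-square density, in the coordinate `z` with `r² = s + √(2s) z + z²`, is dominated
by a multiple of the normal density. -/
theorem radial_density_substitution_le {s : ℕ} (hs : 1 ≤ s) {z : ℝ} (hz : 0 ≤ z) :
    √(s + √(2 * s) * z + z ^ 2) ^ (s - 1)
        * Real.exp (-√(s + √(2 * s) * z + z ^ 2) ^ 2 / 2)
        * ((√(2 * s) + 2 * z) / (2 * √(s + √(2 * s) * z + z ^ 2)))
      ≤ √s ^ s * Real.exp (-s / 2) / √(2 * s) * Real.exp (-z ^ 2 / 2) := by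
  have hs0 : (0 : ℝ) < s := by exact_mod_cast hs
  set b := √(2 * (s : ℝ)) with hb
  have hb0 : 0 < b := Real.sqrt_pos.2 (by positivity)
  have hb2 : b ^ 2 = 2 * s := Real.sq_sqrt (by positivity)
  set w := (s : ℝ) + b * z + z ^ 2 with hw
  have hw0 : 0 < w := by positivity
  have hr0 : 0 < √w := Real.sqrt_pos.2 hw0
  have hr2 : √w ^ 2 = w := Real.sq_sqrt hw0.le
  have hpow : √w ^ s ≤ √s ^ s * Real.exp (b * z / 2) := by
    -- With `u = 2z / b`, `w` is exactly `s (1 + u + u² / 2)`, the second-order Taylor polynomial of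
    -- `s * exp u`. The substitution is chosen for this.
    have hle : √w ≤ √s * Real.exp (z / b) := by
      rw [Real.sqrt_le_left (by positivity), mul_pow, Real.sq_sqrt hs0.le, ← Real.exp_nat_mul]
      have hq := Real.quadratic_le_exp_of_nonneg (x := 2 * (z / b)) (by positivity)
      have : w = s * (1 + 2 * (z / b) + (2 * (z / b)) ^ 2 / 2) := by
        rw [hw]
        field_simp
        rw [show b ^ 2 = 2 * (s : ℝ) from hb2]
        nlinarith [hb2]
      rw [this]
      push_cast
      gcongr
    refine (pow_le_pow_left₀ hr0.le hle s).trans_eq ?_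
    rw [mul_pow, ← Real.exp_nat_mul]
    congr 2
    field_simp
    rw [hb2]
    ring
  have hfrac : (b + 2 * z) / (2 * w) ≤ 1 / b := by
    rw [div_le_div_iff₀ (by positivity) hb0]
    nlinarith [sq_nonneg z]
  have hsplit : √w ^ (s - 1) * Real.exp (-√w ^ 2 / 2) * ((b + 2 * z) / (2 * √w))
      = √w ^ s * ((b + 2 * z) / (2 * w)) * Real.exp (-w / 2) := by
    obtain ⟨k, rfl⟩ : ∃ k, s = k + 1 := ⟨s - 1, by omega⟩
    rw [hr2, Nat.add_sub_cancel, pow_succ, show 2 * w = 2 * (√w * √w) by rw [← sq, hr2]]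
    field_simp
  rw [hsplit]
  calc √w ^ s * ((b + 2 * z) / (2 * w)) * Real.exp (-w / 2)
      ≤ √s ^ s * Real.exp (b * z / 2) * (1 / b) * Real.exp (-w / 2) := by gcongr
    _ = √s ^ s / b * (Real.exp (b * z / 2) * Real.exp (-w / 2)) := by ring
    _ = √s ^ s / b * (Real.exp (-s / 2) * Real.exp (-z ^ 2 / 2)) := by
        rw [← Real.exp_add, ← Real.exp_add]
        congr 2
        rw [hw]
        ring
    _ = _ := by ring

/-- Change of variables `r = √(s + √(2s) z + z²)`, then pointwise domination. For `c = √(2y)` the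
squared lower endpoint is the Laurent–Massart threshold `s + 2√(sy) + 2y`. -/
theorem integral_Ioi_pow_mul_exp_neg_half_sq_le {s : ℕ} (hs : 1 ≤ s) {c : ℝ} (hc : 0 ≤ c) :
    ∫ r in Set.Ioi √(s + √(2 * s) * c + c ^ 2), r ^ (s - 1) * Real.exp (-r ^ 2 / 2)
      ≤ √s ^ s * Real.exp (-s / 2) / √(2 * s) * ∫ z in Set.Ioi c, Real.exp (-z ^ 2 / 2) := by
  have hs0 : (0 : ℝ) < s := by exact_mod_cast hs
  have hw0 : ∀ z ∈ Set.Ici c, 0 < s + √(2 * s) * z + z ^ 2 := fun z hz => by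
    have : 0 ≤ z := hc.trans hz
    positivity
  have hdom : IntegrableOn (fun z => ((fun r : ℝ => r ^ (s - 1) * Real.exp (-r ^ 2 / 2)) ∘
      fun z => √(s + √(2 * s) * z + z ^ 2)) z
        * ((√(2 * s) + 2 * z) / (2 * √(s + √(2 * s) * z + z ^ 2)))) (Set.Ici c) := by
    refine Integrable.mono' (integrable_exp_neg_half_sq.const_mul
      (√s ^ s * Real.exp (-s / 2) / √(2 * s))).integrableOn
      (Measurable.aestronglyMeasurable (by fun_prop)) ?_
    refine (ae_restrict_iff' measurableSet_Ici).2 (ae_of_all _ fun z hz => ?_)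
    have hz0 : 0 ≤ z := hc.trans hz
    rw [Real.norm_of_nonneg (by simp only [Function.comp_apply]; positivity)]
    exact radial_density_substitution_le hs hz0
  rw [← integral_comp_mul_deriv_Ioi (f := fun z => √(s + √(2 * s) * z + z ^ 2))
    (f' := fun z => (√(2 * s) + 2 * z) / (2 * √(s + √(2 * s) * z + z ^ 2)))
    (g := fun r => r ^ (s - 1) * Real.exp (-r ^ 2 / 2)) (a := c) (by fun_prop) ?_ ?_
    (by fun_prop) (integrable_pow_mul_exp_neg_half_sq _).integrableOn hdom, ← integral_const_mul]
  · refine setIntegral_mono_on (hdom.mono_set Set.Ioi_subset_Ici_self)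
      (integrable_exp_neg_half_sq.const_mul _).integrableOn measurableSet_Ioi fun z hz => ?_
    exact radial_density_substitution_le hs (hc.trans (le_of_lt hz))
  · refine Filter.tendsto_atTop_mono' _ ?_ Filter.tendsto_id
    filter_upwards [Filter.eventually_ge_atTop 0] with z hz
    refine Real.le_sqrt_of_sq_le ?_
    have : 0 ≤ √(2 * s) * z := by positivity
    simp only [id]
    linarith
  · intro z hz
    have h1 : HasDerivAt (fun z : ℝ => (s : ℝ) + √(2 * s) * z + z ^ 2)
        (√(2 * s) + 2 * z) z := by
      have := (((hasDerivAt_id z).const_mul √(2 * (s : ℝ))).const_add (s : ℝ)).add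
        (hasDerivAt_pow 2 z)
      simpa [Pi.add_def] using this
    exact (h1.sqrt (hw0 z (Set.Ioi_subset_Ici_self hz)).ne').hasDerivWithinAt

/-! ### Stirling bound for the Gamma function -/

/-- A weak Stirling lower bound at half-integers. -/
theorem stirling_le_Gamma_half_add_one {s : ℕ} (hs : 1 ≤ s) :
    5 / 8 * √(Real.pi * s) * (√(s / 2) ^ s * Real.exp (-s / 2)) ≤ Real.Gamma (s / 2 + 1) := by
  obtain ⟨m, rfl | rfl⟩ := s.even_or_odd'
  · have h := Stirling.le_factorial_stirling m
    have hG : Real.Gamma (((2 * m : ℕ) : ℝ) / 2 + 1) = m.factorial := by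
      rw [← Real.Gamma_nat_eq_factorial]
      congr 1
      push_cast
      ring
    rw [hG]
    refine le_trans ?_ h
    have e1 : √(((2 * m : ℕ) : ℝ) / 2) ^ (2 * m) = (m : ℝ) ^ m := by
      rw [pow_mul, Real.sq_sqrt (by positivity)]
      congr 1
      push_cast
      ring
    have e2 : Real.exp (-((2 * m : ℕ) : ℝ) / 2) = (Real.exp 1)⁻¹ ^ m := by
      rw [← Real.exp_neg, ← Real.exp_nat_mul]
      congr 1
      push_cast
      ring
    rw [e1, e2, show Real.pi * ((2 * m : ℕ) : ℝ) = 2 * Real.pi * m by push_cast; ring,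
      ← mul_pow, ← div_eq_mul_inv]
    have : 0 ≤ √(2 * Real.pi * m) * ((m : ℝ) / Real.exp 1) ^ m := by positivity
    nlinarith
  · refine (sq_le_sq₀ (by positivity) (Real.Gamma_pos_of_pos (by positivity)).le).1 ?_
    have hpi := Real.pi_pos
    have hM : (0 : ℝ) < m + 1 / 2 := by positivity
    have hlhs : (5 / 8 * √(Real.pi * ((2 * m + 1 : ℕ) : ℝ)) *
        (√(((2 * m + 1 : ℕ) : ℝ) / 2) ^ (2 * m + 1) *
          Real.exp (-((2 * m + 1 : ℕ) : ℝ) / 2))) ^ 2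
        = 25 / 32 * Real.pi * (m + 1 / 2) ^ (2 * m + 2) * Real.exp (-(2 * m + 1)) := by
      rw [mul_pow, mul_pow, mul_pow, Real.sq_sqrt (by positivity), ← pow_mul, mul_comm (2 * m + 1),
        pow_mul, Real.sq_sqrt (by positivity), ← Real.exp_nat_mul]
      push_cast
      rw [show (2 : ℝ) * (-(2 * m + 1) / 2) = -(2 * m + 1) by ring, pow_succ _ (2 * m + 1)]
      rw [show ((2 : ℝ) * m + 1) / 2 = m + 1 / 2 by ring]
      ring
    rw [hlhs]
    have hG : Real.Gamma (((2 * m + 1 : ℕ) : ℝ) / 2 + 1)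
        = (m + 1 / 2) * Real.Gamma (m + 1 / 2) := by
      rw [← Real.Gamma_add_one hM.ne']
      congr 1
      push_cast
      ring
    rw [hG]
    -- `m = 0` is checked from `Γ(1/2) = √π`, since the comparison of `m + 1/2` with `m` below
    -- divides by `m`.
    rcases Nat.eq_zero_or_pos m with rfl | hm
    · norm_num [mul_pow, Real.Gamma_one_half_eq, Real.sq_sqrt hpi.le, div_pow]
      have : Real.exp (-1) ≤ 1 := Real.exp_le_one_iff.2 (by norm_num)
      nlinarith
    · have hm0 : (0 : ℝ) < m := by exact_mod_cast hm
      -- Log-convexity at the midpoint `m + 1` of `m + 1/2` and `m + 3/2` reduces the odd case to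
      -- Stirling for `m!`.
      have hconv := Real.Gamma_mul_add_mul_le_rpow_Gamma_mul_rpow_Gamma (s := m + 1 / 2)
        (t := m + 1 / 2 + 1) (a := 1 / 2) (b := 1 / 2) hM (by positivity) (by norm_num)
        (by norm_num) (by norm_num)
      have hGp : 0 < Real.Gamma ((m : ℝ) + 1 / 2) := Real.Gamma_pos_of_pos hM
      rw [Real.Gamma_add_one hM.ne', ← Real.sqrt_eq_rpow, ← Real.sqrt_eq_rpow,
        ← Real.sqrt_mul hGp.le, show (1 / 2 : ℝ) * (m + 1 / 2) + 1 / 2 * (m + 1 / 2 + 1) = m + 1 by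
          ring, Real.Gamma_nat_eq_factorial] at hconv
      have hfac : (m.factorial : ℝ) ^ 2 ≤ (m + 1 / 2) * Real.Gamma (m + 1 / 2) ^ 2 := by
        refine (pow_le_pow_left₀ (by positivity) hconv 2).trans_eq ?_
        rw [Real.sq_sqrt (by positivity)]
        ring
      have hst := pow_le_pow_left₀ (by positivity) (Stirling.le_factorial_stirling m) 2
      rw [mul_pow, Real.sq_sqrt (by positivity), ← pow_mul, mul_comm m 2, div_pow] at hst
      have hratio : ((m : ℝ) + 1 / 2) ^ (2 * m) ≤ (m : ℝ) ^ (2 * m) * Real.exp 1 := by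
        have h1 : (m : ℝ) + 1 / 2 = m * (1 / (2 * m) + 1) := by
          field_simp
          ring
        have h2 := pow_le_pow_left₀ (by positivity) (Real.add_one_le_exp (1 / (2 * (m : ℝ))))
          (2 * m)
        rw [h1, mul_pow]
        refine mul_le_mul_of_nonneg_left (h2.trans_eq ?_) (by positivity)
        rw [← Real.exp_nat_mul]
        congr 1
        push_cast
        field_simp
      have hexp : Real.exp (-(2 * m + 1)) = (Real.exp 1 ^ (2 * m))⁻¹ * (Real.exp 1)⁻¹ := by
        rw [← mul_inv, ← pow_succ, ← Real.exp_nat_mul, ← Real.exp_neg]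
        congr 1
        push_cast
        ring
      -- Used for `25/64 * (m + 1/2) ≤ m`, where the slack in `5/8` absorbs the loss from
      -- log-convexity.
      have hm1 : (1 : ℝ) ≤ m := by exact_mod_cast hm
      calc 25 / 32 * Real.pi * (m + 1 / 2) ^ (2 * m + 2) * Real.exp (-(2 * m + 1))
          = 25 / 32 * Real.pi * ((m + 1 / 2) ^ 2 * (m + 1 / 2) ^ (2 * m))
            * Real.exp (-(2 * m + 1)) := by ring
        _ ≤ 25 / 32 * Real.pi * ((m + 1 / 2) ^ 2 * ((m : ℝ) ^ (2 * m) * Real.exp 1))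
            * Real.exp (-(2 * m + 1)) := by gcongr
        _ = (m + 1 / 2) * ((25 / 64 * (m + 1 / 2)) * (2 * Real.pi)
            * ((m : ℝ) ^ (2 * m) / Real.exp 1 ^ (2 * m))) := by
          rw [hexp]
          have hE : Real.exp 1 * (Real.exp 1)⁻¹ = 1 := mul_inv_cancel₀ (Real.exp_pos 1).ne'
          linear_combination (25 / 32 * Real.pi * (m + 1 / 2) ^ 2 * (m : ℝ) ^ (2 * m)
            * (Real.exp 1 ^ (2 * m))⁻¹) * hE
        _ ≤ (m + 1 / 2) * (m * (2 * Real.pi) * ((m : ℝ) ^ (2 * m) / Real.exp 1 ^ (2 * m))) := by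
          gcongr
          linarith
        _ ≤ (m + 1 / 2) * (m.factorial : ℝ) ^ 2 := by
          refine mul_le_mul_of_nonneg_left (le_trans (le_of_eq ?_) hst) hM.le
          ring
        _ ≤ (m + 1 / 2) * ((m + 1 / 2) * Real.Gamma (m + 1 / 2) ^ 2) := by gcongr
        _ = _ := by ring

/-! ### Norm tails of the standard Gaussian vector -/

/-- Both measures have characteristic function `exp (-‖t‖² / 2)`. The density is what makes polar
coordinates available. -/
theorem stdGaussian_eq_withDensity (ι : Type*) [Fintype ι] :
    stdGaussian (EuclideanSpace ℝ ι) = (volume : Measure (EuclideanSpace ℝ ι)).withDensity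
      fun x => ENNReal.ofReal ((√(2 * Real.pi))⁻¹ ^ Fintype.card ι * Real.exp (-‖x‖ ^ 2 / 2)) := by
  set C : ℝ := (√(2 * Real.pi))⁻¹ ^ Fintype.card ι with hC
  have hhalf : 0 < ((1 / 2 : ℂ)).re := by norm_num
  have hint : Integrable fun x : EuclideanSpace ℝ ι => C * Real.exp (-‖x‖ ^ 2 / 2) := by
    refine Integrable.const_mul ?_ _
    have h := (GaussianFourier.integrable_cexp_neg_mul_sq_norm_add hhalf 0
      (0 : EuclideanSpace ℝ ι)).norm
    refine h.congr (ae_of_all _ fun x => ?_)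
    have : (-(1 / 2) * (‖x‖ : ℂ) ^ 2 + 0 * (inner ℝ (0 : EuclideanSpace ℝ ι) x : ℂ))
        = ((-‖x‖ ^ 2 / 2 : ℝ) : ℂ) := by
      push_cast
      ring
    simp only [this, Complex.norm_exp_ofReal]
  have hfin : IsFiniteMeasure ((volume : Measure (EuclideanSpace ℝ ι)).withDensity
      fun x => ENNReal.ofReal (C * Real.exp (-‖x‖ ^ 2 / 2))) :=
    isFiniteMeasure_withDensity_ofReal hint.2
  refine Measure.ext_of_charFun ?_
  ext t
  rw [charFun_stdGaussian, charFun_apply, integral_withDensity_eq_integral_toReal_smul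
    (by fun_prop) (by simp)]
  have h := GaussianFourier.integral_cexp_neg_mul_sq_norm_add hhalf Complex.I t
  have hpow : ((Real.pi : ℂ) / (1 / 2)) ^ (Module.finrank ℝ (EuclideanSpace ℝ ι) / 2 : ℂ)
      = ((√(2 * Real.pi) ^ Fintype.card ι : ℝ) : ℂ) := by
    rw [finrank_euclideanSpace, Real.sqrt_eq_rpow, ← Real.rpow_natCast, ← Real.rpow_mul
      (by positivity), Complex.ofReal_cpow (by positivity)]
    congr 1
    · push_cast
      ring
    · push_cast
      ring
  rw [hpow] at h
  have hcongr : ∀ x : EuclideanSpace ℝ ι,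
      (ENNReal.ofReal (C * Real.exp (-‖x‖ ^ 2 / 2))).toReal •
        Complex.exp ((inner ℝ x t : ℝ) * Complex.I)
      = (C : ℂ) * Complex.exp (-(1 / 2) * (‖x‖ : ℂ) ^ 2 + Complex.I * (inner ℝ t x : ℝ)) := by
    intro x
    rw [ENNReal.toReal_ofReal (by positivity), Complex.real_smul, Complex.ofReal_mul,
      Complex.ofReal_exp, mul_assoc, ← Complex.exp_add, real_inner_comm]
    congr 2
    push_cast
    ring
  simp_rw [hcongr]
  rw [integral_const_mul, h, ← mul_assoc, ← Complex.ofReal_mul, hC, inv_pow,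
    inv_mul_cancel₀ (by positivity), Complex.ofReal_one, one_mul, Complex.I_sq]
  congr 1
  ring

/-- Polar integration of the density: the sphere contributes `d` times the volume of the unit ball.
-/
theorem stdGaussian_real_norm_ge_le (ι : Type*) [Fintype ι] [Nonempty ι] {c : ℝ} (hc : 0 ≤ c) :
    (stdGaussian (EuclideanSpace ℝ ι)).real {x | c ≤ ‖x‖} ≤
      (√(2 * Real.pi))⁻¹ ^ Fintype.card ι * (Fintype.card ι *
        (√Real.pi ^ Fintype.card ι / Real.Gamma (Fintype.card ι / 2 + 1))) *
        ∫ r in Set.Ioi c, r ^ (Fintype.card ι - 1) * Real.exp (-r ^ 2 / 2) := by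
  set d := Fintype.card ι with hd
  set C : ℝ := (√(2 * Real.pi))⁻¹ ^ d with hC
  have hmeas : MeasurableSet {x : EuclideanSpace ℝ ι | c ≤ ‖x‖} :=
    measurableSet_le measurable_const measurable_norm
  rw [← integral_indicator_one hmeas, stdGaussian_eq_withDensity,
    integral_withDensity_eq_integral_toReal_smul (by fun_prop) (by simp)]
  have hF : ∀ x : EuclideanSpace ℝ ι,
      (ENNReal.ofReal (C * Real.exp (-‖x‖ ^ 2 / 2))).toReal •
        {x : EuclideanSpace ℝ ι | c ≤ ‖x‖}.indicator (1 : EuclideanSpace ℝ ι → ℝ) x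
      = (Set.Ici c).indicator (fun r => C * Real.exp (-r ^ 2 / 2)) ‖x‖ := by
    intro x
    rw [ENNReal.toReal_ofReal (by positivity)]
    by_cases h : c ≤ ‖x‖ <;> simp [Set.indicator, h]
  simp_rw [← hd, ← hC, hF]
  rw [integral_fun_norm_addHaar, finrank_euclideanSpace, ← hd]
  have hball : (volume : Measure (EuclideanSpace ℝ ι)).real (Metric.ball 0 1)
      = √Real.pi ^ d / Real.Gamma (d / 2 + 1) := by
    rw [Measure.real, EuclideanSpace.volume_ball, ENNReal.ofReal_one, one_pow, one_mul,
      ENNReal.toReal_ofReal]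
    have : 0 < Real.Gamma ((d : ℝ) / 2 + 1) := Real.Gamma_pos_of_pos (by positivity)
    positivity
  have hG : 0 < Real.Gamma ((d : ℝ) / 2 + 1) := Real.Gamma_pos_of_pos (by positivity)
  rw [hball, nsmul_eq_mul, smul_eq_mul]
  have hind : ∀ y : ℝ, y ^ (d - 1) • (Set.Ici c).indicator (fun r => C * Real.exp (-r ^ 2 / 2)) y
      = (Set.Ici c).indicator (fun r => C * (r ^ (d - 1) * Real.exp (-r ^ 2 / 2))) y := by
    intro y
    by_cases h : y ∈ Set.Ici c
    · simp only [Set.indicator_of_mem h, smul_eq_mul]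
      ring
    · simp [Set.indicator_of_notMem h]
  simp_rw [hind]
  rw [setIntegral_indicator measurableSet_Ici]
  have hle : ∫ r in Set.Ioi 0 ∩ Set.Ici c, C * (r ^ (d - 1) * Real.exp (-r ^ 2 / 2))
      ≤ C * ∫ r in Set.Ioi c, r ^ (d - 1) * Real.exp (-r ^ 2 / 2) := by
    rw [← integral_const_mul, ← integral_Ici_eq_integral_Ioi]
    refine setIntegral_mono_set ((integrable_pow_mul_exp_neg_half_sq _).const_mul C).integrableOn
      ?_ (Filter.Eventually.of_forall Set.inter_subset_right)
    refine (ae_restrict_iff' measurableSet_Ici).2 (ae_of_all _ fun z hz => ?_)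
    have : 0 ≤ z := hc.trans hz
    simp only [Pi.zero_apply]
    positivity
  refine (mul_le_mul_of_nonneg_left (mul_le_mul_of_nonneg_left hle ?_) ?_).trans_eq ?_
  · positivity
  · positivity
  · ring

/-- A sharpened Laurent–Massart inequality, with a constant below one. -/
theorem stdGaussian_real_norm_sq_ge_le (ι : Type*) [Fintype ι] [Nonempty ι] {y : ℝ} (hy : 0 ≤ y) :
    (stdGaussian (EuclideanSpace ℝ ι)).real
      {x | 2 * y + 2 * √(Fintype.card ι * y) + Fintype.card ι ≤ ‖x‖ ^ 2}
      ≤ 4 / 5 * Real.exp (-y) := by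
  have hs : 1 ≤ Fintype.card ι := Fintype.card_pos
  have hset : {x : EuclideanSpace ℝ ι |
      2 * y + 2 * √(Fintype.card ι * y) + Fintype.card ι ≤ ‖x‖ ^ 2}
      = {x | √(Fintype.card ι + √(2 * Fintype.card ι) * √(2 * y) + √(2 * y) ^ 2) ≤ ‖x‖} := by
    ext x
    simp only [Set.mem_ofPred_eq]
    rw [Real.sqrt_le_left (norm_nonneg x), Real.sq_sqrt (by positivity),
      ← Real.sqrt_mul (show (0 : ℝ) ≤ 2 * Fintype.card ι by positivity),
      show 2 * (Fintype.card ι : ℝ) * (2 * y)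
        = 2 ^ 2 * (Fintype.card ι * y) by ring,
      Real.sqrt_mul (show (0 : ℝ) ≤ 2 ^ 2 by norm_num), Real.sqrt_sq (by norm_num)]
    constructor <;> intro h <;> linarith
  rw [hset]
  refine (stdGaussian_real_norm_ge_le ι (Real.sqrt_nonneg _)).trans ?_
  set s := Fintype.card ι with hsdef
  have hs0 : (0 : ℝ) < s := by exact_mod_cast hs
  have hG : 0 < Real.Gamma ((s : ℝ) / 2 + 1) := Real.Gamma_pos_of_pos (by positivity)
  have hst := stirling_le_Gamma_half_add_one hs
  have hrad := integral_Ioi_pow_mul_exp_neg_half_sq_le hs (Real.sqrt_nonneg (2 * y))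
  have hnorm := integral_Ioi_exp_neg_half_sq_le (Real.sqrt_nonneg (2 * y))
  rw [Real.sq_sqrt (by positivity), show -(2 * y) / 2 = -y by ring] at hnorm
  have hpi := Real.pi_pos
  calc (√(2 * Real.pi))⁻¹ ^ s * (s * (√Real.pi ^ s / Real.Gamma (s / 2 + 1))) *
        ∫ r in Set.Ioi √(s + √(2 * s) * √(2 * y) + √(2 * y) ^ 2),
          r ^ (s - 1) * Real.exp (-r ^ 2 / 2)
      ≤ (√(2 * Real.pi))⁻¹ ^ s * (s * (√Real.pi ^ s / Real.Gamma (s / 2 + 1))) *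
          (√s ^ s * Real.exp (-s / 2) / √(2 * s) * (Real.exp (-y) * (√(2 * Real.pi) / 2))) := by
        gcongr
        exact hrad.trans (by gcongr)
    _ = (1 / 2 * √(Real.pi * s) * (√(s / 2) ^ s * Real.exp (-s / 2))) /
          Real.Gamma (s / 2 + 1) * Real.exp (-y) := by
        have e1 : √(s / 2 : ℝ) ^ s = (√2)⁻¹ ^ s * √s ^ s := by
          rw [Real.sqrt_div hs0.le, div_eq_inv_mul, mul_pow]
        have e2 : (√(2 * Real.pi))⁻¹ ^ s * √Real.pi ^ s = (√2)⁻¹ ^ s := by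
          rw [← mul_pow, Real.sqrt_mul (by norm_num)]
          congr 1
          have : √Real.pi ≠ 0 := (Real.sqrt_pos.2 hpi).ne'
          field_simp
        have e3 : s * (√(2 * Real.pi) / √(2 * s)) = √(Real.pi * s) := by
          rw [Real.sqrt_mul (by norm_num), Real.sqrt_mul (by norm_num),
            Real.sqrt_mul hpi.le]
          nth_rewrite 1 [← Real.mul_self_sqrt hs0.le]
          field_simp
        rw [e1, ← e2, ← e3]
        ring
    _ ≤ 4 / 5 * Real.exp (-y) := by
        -- The Stirling bound leaves `(1/2) / (5/8) = 4/5`.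
        refine mul_le_mul_of_nonneg_right ?_ (Real.exp_pos _).le
        rw [div_le_iff₀ hG]
        linarith

/-- The two-sided normal tail bound without a factor two. -/
theorem stdGaussian_real_norm_sq_ge_le_of_card_eq_one (ι : Type*) [Fintype ι]
    (hι : Fintype.card ι = 1) {y : ℝ} (hy : 0 ≤ y) :
    (stdGaussian (EuclideanSpace ℝ ι)).real {x | 2 * y ≤ ‖x‖ ^ 2} ≤ Real.exp (-y) := by
  have : Nonempty ι := Fintype.card_pos_iff.1 (by omega)
  have hset : {x : EuclideanSpace ℝ ι | 2 * y ≤ ‖x‖ ^ 2} = {x | √(2 * y) ≤ ‖x‖} := by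
    ext x
    simp only [Set.mem_ofPred_eq]
    rw [Real.sqrt_le_left (norm_nonneg x)]
  rw [hset]
  refine (stdGaussian_real_norm_ge_le ι (Real.sqrt_nonneg _)).trans ?_
  have hnorm := integral_Ioi_exp_neg_half_sq_le (Real.sqrt_nonneg (2 * y))
  rw [Real.sq_sqrt (by positivity), show -(2 * y) / 2 = -y by ring] at hnorm
  have hG : Real.Gamma ((1 : ℝ) / 2 + 1) = 1 / 2 * √Real.pi := by
    rw [Real.Gamma_add_one (by norm_num), Real.Gamma_one_half_eq]
  have hpi := Real.pi_pos
  rw [hι]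
  simp only [pow_one, Nat.cast_one, Nat.sub_self, pow_zero, one_mul, hG]
  have h2 : √Real.pi ≠ 0 := (Real.sqrt_pos.2 hpi).ne'
  have h3 : √(2 * Real.pi) ≠ 0 := (Real.sqrt_pos.2 (by positivity)).ne'
  refine (mul_le_mul_of_nonneg_left hnorm (by positivity)).trans_eq ?_
  field_simp

/-! ### Coordinate subsets and the rank statistics -/

/-- Extending `t` by zero outside `I` preserves inner products and the norm, so the characteristic
functions agree. -/
theorem stdGaussian_map_restrict {ι : Type*} [Fintype ι] (I : Finset ι) :
    (stdGaussian (EuclideanSpace ℝ ι)).map (fun x => WithLp.toLp 2 fun i : I => x i)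
      = stdGaussian (EuclideanSpace ℝ I) := by
  classical
  have hmeas : Measurable fun x : EuclideanSpace ℝ ι =>
      (WithLp.toLp 2 fun i : I => x i : EuclideanSpace ℝ I) := by fun_prop
  have := Measure.isProbabilityMeasure_map (μ := stdGaussian (EuclideanSpace ℝ ι))
    hmeas.aemeasurable
  refine Measure.ext_of_charFun ?_
  ext t
  set t' : EuclideanSpace ℝ ι :=
    WithLp.toLp 2 fun i => if h : i ∈ I then t ⟨i, h⟩ else 0 with ht'
  have hinner : ∀ x : EuclideanSpace ℝ ι,
      inner ℝ (WithLp.toLp 2 fun i : I => x i : EuclideanSpace ℝ I) t = inner ℝ x t' := by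
    intro x
    simp only [PiLp.inner_apply]
    rw [← Finset.sum_subset (Finset.subset_univ I), ← Finset.sum_coe_sort I]
    · refine Finset.sum_congr rfl fun i _ => ?_
      simp [ht']
    · intro i _ hi
      simp [ht', hi]
  have hnorm : ‖t'‖ ^ 2 = ‖t‖ ^ 2 := by
    rw [← real_inner_self_eq_norm_sq, ← real_inner_self_eq_norm_sq, ← hinner]
    congr 1
    ext i
    simp [ht']
  rw [charFun_stdGaussian, charFun_apply, integral_map hmeas.aemeasurable
    (Measurable.aestronglyMeasurable (by fun_prop))]
  simp_rw [hinner]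
  rw [← charFun_apply, charFun_stdGaussian, ← Complex.ofReal_pow, hnorm, Complex.ofReal_pow]

variable {Ω : Type*} [MeasurableSpace Ω] {P : Measure Ω} {p : ℕ}

theorem measure_sum_sq_ge_eq {X : Ω → EuclideanSpace ℝ (Fin p)}
    (hX : HasLaw X (stdGaussian (EuclideanSpace ℝ (Fin p))) P) (I : Finset (Fin p)) (u : ℝ) :
    P {ω | u ≤ ∑ i ∈ I, X ω i ^ 2}
      = ENNReal.ofReal ((stdGaussian (EuclideanSpace ℝ I)).real {x | u ≤ ‖x‖ ^ 2}) := by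
  have hm : MeasurableSet {x : EuclideanSpace ℝ I | u ≤ ‖x‖ ^ 2} :=
    measurableSet_le measurable_const (by fun_prop)
  rw [ofReal_measureReal, ← stdGaussian_map_restrict, Measure.map_apply (by fun_prop) hm,
    hX.measure_eq (p := fun x => u ≤ ∑ i ∈ I, x i ^ 2)
      (measurableSet_le measurable_const (by fun_prop))]
  congr 1
  ext x
  simp only [Set.mem_ofPred_eq, Set.mem_preimage, EuclideanSpace.norm_sq_eq, Real.norm_eq_abs,
    sq_abs]
  rw [← Finset.sum_coe_sort I]

theorem measure_sum_sq_ge_rank_le {X : Ω → EuclideanSpace ℝ (Fin p)}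
    (hX : HasLaw X (stdGaussian (EuclideanSpace ℝ (Fin p))) P) {I : Finset (Fin p)} {s : ℕ}
    (hs : 1 ≤ s) (hI : I.card = s) {y : ℝ} (hy : 0 ≤ y) :
    P {ω | 2 * y + 2 * √(s * y) + s ≤ ∑ i ∈ I, X ω i ^ 2}
      ≤ ENNReal.ofReal (4 / 5 * Real.exp (-y)) := by
  rw [measure_sum_sq_ge_eq hX]
  have hne : Nonempty I := (Finset.card_pos.1 (by omega)).to_subtype
  have h := stdGaussian_real_norm_sq_ge_le I hy
  rw [Fintype.card_coe, hI] at h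
  exact ENNReal.ofReal_le_ofReal h

theorem measure_sum_sq_ge_one_le {X : Ω → EuclideanSpace ℝ (Fin p)}
    (hX : HasLaw X (stdGaussian (EuclideanSpace ℝ (Fin p))) P) {I : Finset (Fin p)}
    (hI : I.card = 1) {y : ℝ} (hy : 0 ≤ y) :
    P {ω | 2 * y ≤ ∑ i ∈ I, X ω i ^ 2} ≤ ENNReal.ofReal (Real.exp (-y)) := by
  rw [measure_sum_sq_ge_eq hX]
  exact ENNReal.ofReal_le_ofReal
    (stdGaussian_real_norm_sq_ge_le_of_card_eq_one I (by rw [Fintype.card_coe, hI]) hy)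

/-- Sorting is a permutation, so the first `s` positions come from `s` distinct coordinates. Nothing
about the score enters, hence both rankings are covered at once. -/
theorem exists_rankStat_eq_sum (r : Ranking) {s : ℕ} (hs : s ≤ p) (e : Fin p → ℝ) :
    ∃ I ∈ Finset.powersetCard s (Finset.univ : Finset (Fin p)),
      rankStat r s e = ∑ i ∈ I, e i ^ 2 := by
  refine ⟨(Finset.univ.filter fun j : Fin p => j.val < s).map
    (Tuple.sort fun i => -r.score (e i)).toEmbedding, ?_, ?_⟩
  · rw [Finset.mem_powersetCard]
    refine ⟨Finset.subset_univ _, ?_⟩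
    rw [Finset.card_map, Fin.card_filter_val_lt, min_eq_right hs]
  · rw [Finset.sum_map]
    rfl

theorem measure_rankStat_ge_le (X : Ω → EuclideanSpace ℝ (Fin p)) (r : Ranking) {s : ℕ}
    (hs : s ≤ p) {u b : ℝ}
    (h : ∀ I : Finset (Fin p), I.card = s →
      P {ω | u ≤ ∑ i ∈ I, X ω i ^ 2} ≤ ENNReal.ofReal b) :
    P {ω | u ≤ rankStat r s (X ω)} ≤ ENNReal.ofReal (p.choose s * b) := by
  have hsub : {ω | u ≤ rankStat r s (X ω)} ⊆
      ⋃ I ∈ Finset.powersetCard s (Finset.univ : Finset (Fin p)),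
        {ω | u ≤ ∑ i ∈ I, X ω i ^ 2} := by
    intro ω hω
    obtain ⟨I, hI, hI'⟩ := exists_rankStat_eq_sum r hs (X ω)
    simp only [Set.mem_iUnion]
    exact ⟨I, hI, le_of_le_of_eq hω hI'⟩
  refine (measure_mono hsub).trans ((measure_biUnion_finset_le _ _).trans ?_)
  refine (Finset.sum_le_sum fun I hI => h I (Finset.mem_powersetCard.1 hI).2).trans_eq ?_
  rw [Finset.sum_const, Finset.card_powersetCard, Finset.card_univ, Fintype.card_fin,
    ENNReal.ofReal_mul (by positivity), ENNReal.ofReal_natCast, nsmul_eq_mul]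

/-! ### Exponential moments and the thresholded statistic -/

theorem integrable_exp_mul_sq_gaussianReal {b : ℝ} (hb : b < 1 / 2) :
    Integrable (fun z : ℝ => Real.exp (b * z ^ 2)) (gaussianReal 0 1) := by
  rw [gaussianReal_of_var_ne_zero _ one_ne_zero, integrable_withDensity_iff
    (measurable_gaussianPDF _ _) (ae_of_all _ fun _ => gaussianPDF_lt_top)]
  refine ((integrable_exp_neg_mul_sq (b := 1 / 2 - b) (by linarith)).const_mul
    (√(2 * Real.pi))⁻¹).congr (ae_of_all _ fun z => ?_)
  simp only [toReal_gaussianPDF, gaussianPDFReal, NNReal.coe_one, mul_one, sub_zero]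
  rw [mul_left_comm, ← Real.exp_add]
  congr 2
  ring

theorem integral_exp_mul_sq_gaussianReal (b : ℝ) :
    ∫ z, Real.exp (b * z ^ 2) ∂gaussianReal 0 1 = √(1 / (1 - 2 * b)) := by
  rw [integral_gaussianReal_eq_integral_smul one_ne_zero]
  have : ∀ z : ℝ, gaussianPDFReal 0 1 z • Real.exp (b * z ^ 2)
      = (√(2 * Real.pi))⁻¹ * Real.exp (-(1 / 2 - b) * z ^ 2) := by
    intro z
    simp only [gaussianPDFReal, NNReal.coe_one, mul_one, sub_zero, smul_eq_mul]
    rw [mul_assoc, ← Real.exp_add]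
    congr 2
    ring
  simp_rw [this]
  rw [integral_const_mul, integral_gaussian, ← Real.sqrt_inv, ← Real.sqrt_mul (by positivity)]
  congr 1
  have := Real.pi_pos
  rw [show (1 : ℝ) / 2 - b = (1 - 2 * b) / 2 by ring]
  field_simp

theorem thresholdedStat_eq_sum (a : ℝ) (e : Fin p → ℝ) :
    thresholdedStat a e = ∑ i, if a ≤ |e i| then e i ^ 2 else 0 := by
  rw [thresholdedStat, Finset.sum_filter]

theorem measurable_exp_threshold (a : ℝ) :
    Measurable fun z : ℝ => Real.exp ((if a ≤ |z| then z ^ 2 else 0) / 4) := by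
  refine Real.measurable_exp.comp (Measurable.div_const ?_ _)
  exact Measurable.ite (measurableSet_le measurable_const (by fun_prop)) (by fun_prop) (by fun_prop)

theorem integrable_exp_threshold (a : ℝ) :
    Integrable (fun z : ℝ => Real.exp ((if a ≤ |z| then z ^ 2 else 0) / 4))
      (gaussianReal 0 1) := by
  refine Integrable.mono' (integrable_exp_mul_sq_gaussianReal (b := 1 / 4) (by norm_num))
    (measurable_exp_threshold a).aestronglyMeasurable (ae_of_all _ fun z => ?_)
  rw [Real.norm_of_nonneg (Real.exp_pos _).le, Real.exp_le_exp]
  split_ifs <;> nlinarith [sq_nonneg z]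

/-- On `|z| ≥ a` the factor `exp ((z² - a²) / 8)` is at least one, so inserting it only increases
the excess `exp (z² / 4) - 1`. The remaining Gaussian moments are `2` and `√(4/3) ≥ 1`, whose
difference is at most one. -/
theorem integral_exp_threshold_le {a : ℝ} (ha : 0 ≤ a) :
    ∫ z, Real.exp ((if a ≤ |z| then z ^ 2 else 0) / 4) ∂gaussianReal 0 1
      ≤ 1 + Real.exp (-a ^ 2 / 8) := by
  have h3 := integrable_exp_mul_sq_gaussianReal (b := 3 / 8) (by norm_num)
  have h1 := integrable_exp_mul_sq_gaussianReal (b := 1 / 8) (by norm_num)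
  have hd : Integrable (fun z : ℝ => Real.exp (-a ^ 2 / 8) *
      (Real.exp (3 / 8 * z ^ 2) - Real.exp (1 / 8 * z ^ 2))) (gaussianReal 0 1) :=
    (h3.sub h1).const_mul _
  have hle : ∀ z : ℝ, Real.exp ((if a ≤ |z| then z ^ 2 else 0) / 4)
      ≤ 1 + Real.exp (-a ^ 2 / 8) *
        (Real.exp (3 / 8 * z ^ 2) - Real.exp (1 / 8 * z ^ 2)) := by
    intro z
    have hdiff : Real.exp (3 / 8 * z ^ 2) - Real.exp (1 / 8 * z ^ 2)
        = Real.exp (z ^ 2 / 8) * (Real.exp (z ^ 2 / 4) - 1) := by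
      rw [mul_sub, ← Real.exp_add]
      ring_nf
    have hpos : 0 ≤ Real.exp (z ^ 2 / 4) - 1 :=
      sub_nonneg.2 (Real.one_le_exp (by positivity))
    rw [hdiff, ← mul_assoc, ← Real.exp_add]
    split_ifs with h
    · have hsq : a ^ 2 ≤ z ^ 2 := by
        rw [← sq_abs z]
        exact pow_le_pow_left₀ ha h 2
      have : 1 ≤ Real.exp (-a ^ 2 / 8 + z ^ 2 / 8) := Real.one_le_exp (by linarith)
      nlinarith
    · rw [zero_div, Real.exp_zero]
      have := mul_nonneg (Real.exp_pos (-a ^ 2 / 8 + z ^ 2 / 8)).le hpos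
      linarith
  refine (integral_mono (integrable_exp_threshold a)
    ((integrable_const 1).add hd) hle).trans ?_
  rw [integral_add' (integrable_const 1) hd, integral_const_mul, integral_sub h3 h1,
    integral_exp_mul_sq_gaussianReal, integral_exp_mul_sq_gaussianReal]
  have e1 : √(1 / (1 - 2 * (3 / 8)) : ℝ) = 2 := by
    rw [show (1 / (1 - 2 * (3 / 8)) : ℝ) = 2 ^ 2 by norm_num, Real.sqrt_sq (by norm_num)]
  have e2 : 1 ≤ √(1 / (1 - 2 * (1 / 8)) : ℝ) := Real.one_le_sqrt.2 (by norm_num)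
  rw [e1]
  have hq := Real.exp_pos (-a ^ 2 / 8)
  simp only [integral_const, probReal_univ, smul_eq_mul, mul_one]
  nlinarith

theorem integrable_exp_thresholdedStat {X : Ω → EuclideanSpace ℝ (Fin p)}
    (hX : HasLaw X (stdGaussian (EuclideanSpace ℝ (Fin p))) P) {a : ℝ} (ha : 0 ≤ a) :
    Integrable (fun ω => Real.exp (thresholdedStat a (X ω) / 4)) P ∧
      ∫ ω, Real.exp (thresholdedStat a (X ω) / 4) ∂P ≤ Real.exp (p * Real.exp (-a ^ 2 / 8)) := by
  set f : ℝ → ℝ := fun z => Real.exp ((if a ≤ |z| then z ^ 2 else 0) / 4) with hf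
  have hprod : ∀ e : Fin p → ℝ, Real.exp (thresholdedStat a e / 4) = ∏ i, f (e i) := by
    intro e
    rw [thresholdedStat_eq_sum, Finset.sum_div, Real.exp_sum]
  have hfm : Measurable f := measurable_exp_threshold a
  have hgm : Measurable fun x : EuclideanSpace ℝ (Fin p) => ∏ i, f (x i) :=
    Finset.measurable_fun_prod _ fun i _ => hfm.comp (by fun_prop)
  have hto : Measurable (WithLp.toLp 2 : (Fin p → ℝ) → EuclideanSpace ℝ (Fin p)) := by fun_prop
  simp_rw [hprod]
  have hpi : Integrable (fun x : Fin p → ℝ => ∏ i, f (x i))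
      (Measure.pi fun _ => gaussianReal 0 1) :=
    Integrable.fintype_prod fun _ => integrable_exp_threshold a
  constructor
  · have h : Integrable (fun x : EuclideanSpace ℝ (Fin p) => ∏ i, f (x i)) (P.map X) := by
      rw [hX.map_eq, ← map_pi_eq_stdGaussian, integrable_map_measure
        hgm.aestronglyMeasurable hto.aemeasurable]
      exact hpi
    exact (integrable_map_measure hgm.aestronglyMeasurable hX.aemeasurable).1 h
  · rw [← integral_map (f := fun x : EuclideanSpace ℝ (Fin p) => ∏ i, f (x i)) hX.aemeasurable
      hgm.aestronglyMeasurable, hX.map_eq, ← map_pi_eq_stdGaussian,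
      integral_map hto.aemeasurable hgm.aestronglyMeasurable]
    have h := integral_fintype_prod_eq_prod (𝕜 := ℝ) (fun _ : Fin p => f)
      (μ := fun _ => gaussianReal 0 1)
    refine (le_of_eq h).trans ?_
    rw [Finset.prod_const, Finset.card_univ, Fintype.card_fin, Real.exp_nat_mul]
    refine pow_le_pow_left₀ (integral_nonneg fun z => (Real.exp_pos _).le) ?_ _
    refine (integral_exp_threshold_le ha).trans ?_
    rw [add_comm]
    exact Real.add_one_le_exp _

/-- With `t = exp (w / 2)` this reduces to `2t³ - 3t² + 1 = (t - 1)² (2t + 1) ≥ 0`. It bounds the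
Markov quotient by `2/3 * exp (-x)`. -/
theorem exp_sub_one_le_two_thirds {x w : ℝ} (hx : 0 ≤ x) :
    3 * Real.exp x * (Real.exp w - 1) ≤ 2 * (Real.exp (x + 3 / 2 * w) - 1) := by
  have h1 : Real.exp w = Real.exp (w / 2) ^ 2 := by
    rw [← Real.exp_nat_mul]
    congr 1
    push_cast
    ring
  have h2 : Real.exp (x + 3 / 2 * w) = Real.exp x * Real.exp (w / 2) ^ 3 := by
    rw [← Real.exp_nat_mul, ← Real.exp_add]
    congr 1
    push_cast
    ring
  rw [h1, h2]
  set t := Real.exp (w / 2)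
  have ht : 0 < t := Real.exp_pos _
  have hE : 1 ≤ Real.exp x := Real.one_le_exp hx
  have hcubic : 0 ≤ (t - 1) ^ 2 * (2 * t + 1) := by positivity
  nlinarith [mul_nonneg (Real.exp_pos x).le hcubic]

theorem measure_thresholdedStat_ge_le [IsProbabilityMeasure P] {X : Ω → EuclideanSpace ℝ (Fin p)}
    (hX : HasLaw X (stdGaussian (EuclideanSpace ℝ (Fin p))) P) {a : ℝ} (ha : 0 ≤ a) {x : ℝ}
    (hx : 0 < x) :
    P {ω | 4 * x + 6 * p * Real.exp (-a ^ 2 / 8) ≤ thresholdedStat a (X ω)}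
      ≤ ENNReal.ofReal (4 / 5 * Real.exp (-x)) := by
  obtain ⟨hint, hle⟩ := integrable_exp_thresholdedStat hX ha
  set w := p * Real.exp (-a ^ 2 / 8) with hw
  have hw0 : 0 ≤ w := by positivity
  have hK : 1 < Real.exp (x + 3 / 2 * w) := Real.one_lt_exp_iff.2 (by positivity)
  -- Applied to `exp (T / 4) - 1`, which is nonnegative because `T ≥ 0`. The threshold `4x + 6w`
  -- becomes the exponent `x + 3w/2`.
  have hmarkov := mul_meas_ge_le_integral_of_nonneg (μ := P)
    (f := fun ω => Real.exp (thresholdedStat a (X ω) / 4) - 1)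
    (ae_of_all _ fun ω => sub_nonneg.2 (Real.one_le_exp (div_nonneg
      (Finset.sum_nonneg fun i _ => sq_nonneg _) (by norm_num))))
    (hint.sub (integrable_const 1)) (Real.exp (x + 3 / 2 * w) - 1)
  rw [integral_sub hint (integrable_const 1)] at hmarkov
  simp only [integral_const, probReal_univ, smul_eq_mul, mul_one] at hmarkov
  have hset : {ω | 4 * x + 6 * p * Real.exp (-a ^ 2 / 8) ≤ thresholdedStat a (X ω)}
      = {ω | Real.exp (x + 3 / 2 * w) - 1 ≤ Real.exp (thresholdedStat a (X ω) / 4) - 1} := by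
    ext ω
    simp only [Set.mem_ofPred_eq, sub_le_sub_iff_right, Real.exp_le_exp]
    rw [le_div_iff₀ (by norm_num), hw]
    constructor <;> intro h <;> linarith
  rw [hset, ← ofReal_measureReal]
  refine ENNReal.ofReal_le_ofReal ?_
  set μ := P.real {ω | Real.exp (x + 3 / 2 * w) - 1 ≤
    Real.exp (thresholdedStat a (X ω) / 4) - 1}
  have hkey := exp_sub_one_le_two_thirds (w := w) hx.le
  have hμ : 3 * Real.exp x * μ ≤ 2 := by
    have hK0 : 0 < Real.exp (x + 3 / 2 * w) - 1 := by linarith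
    refine le_of_mul_le_mul_left ?_ hK0
    have hE := Real.exp_pos x
    nlinarith [mul_le_mul_of_nonneg_left (hmarkov.trans (sub_le_sub_right hle 1))
      (show 0 ≤ 3 * Real.exp x by positivity)]
  rw [Real.exp_neg, ← div_eq_mul_inv, le_div_iff₀ (Real.exp_pos x)]
  linarith

/-! ### Gaussian law of the evidence vector -/

theorem hasLaw_weighted_sum [IsProbabilityMeasure P] {ε : ℕ → Ω → EuclideanSpace ℝ (Fin p)}
    (hlaw : ∀ t : ℕ, 1 ≤ t → HasLaw (ε t) (multivariateGaussian 0 1) P)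
    (hindep : iIndepFun (fun t : ℕ => ε (t + 1)) P) (n : ℕ) (w : ℕ → ℝ)
    (hw : ∑ k ∈ Finset.range n, w k ^ 2 = 1) :
    HasLaw (fun ω => ∑ k ∈ Finset.range n, w k • ε (k + 1) ω)
      (stdGaussian (EuclideanSpace ℝ (Fin p))) P := by
  have hε : ∀ k, HasLaw (ε (k + 1)) (stdGaussian (EuclideanSpace ℝ (Fin p))) P := fun k => by
    rw [← multivariateGaussian_zero_one]
    exact hlaw (k + 1) (by omega)
  have hm : ∀ k, AEMeasurable (fun ω => w k • ε (k + 1) ω) P := fun k =>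
    (hε k).aemeasurable.const_smul (w k)
  have hsum : AEMeasurable (fun ω => ∑ k ∈ Finset.range n, w k • ε (k + 1) ω) P :=
    Finset.aemeasurable_fun_sum _ fun k _ => hm k
  refine ⟨hsum, ?_⟩
  have := Measure.isProbabilityMeasure_map hsum
  have hind : iIndepFun (fun k ω => w k • ε (k + 1) ω) P :=
    hindep.comp (fun k x => w k • x) fun k => by fun_prop
  refine Measure.ext_of_charFun ?_
  rw [(hind.restrict (Finset.range n)).charFun_map_fun_finsetSum_eq_prod fun k _ => hm k]
  ext t
  rw [Finset.prod_apply, charFun_stdGaussian]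
  have hk : ∀ k, charFun (P.map fun ω => w k • ε (k + 1) ω) t
      = Complex.exp ((w k ^ 2 : ℝ) * (-(‖t‖ : ℂ) ^ 2 / 2)) := by
    intro k
    rw [charFun_map_smul_comp (hε k).aemeasurable, (hε k).map_eq, charFun_stdGaussian, norm_smul]
    congr 1
    rw [← Complex.ofReal_pow, mul_pow, Real.norm_eq_abs, sq_abs]
    push_cast
    ring
  simp_rw [hk]
  rw [← Complex.exp_sum, ← Finset.sum_mul, ← Complex.ofReal_sum, hw, Complex.ofReal_one, one_mul]

/-- The weight of observation `k + 1` in the evidence. -/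
noncomputable def evidenceWeight (τ n : ℕ) : PreChangeMean → ℕ → ℝ
  | .known, k => if τ ≤ k then 1 / √((n : ℝ) - τ) else 0
  | .unknown, k => √((τ : ℝ) * ((n : ℝ) - τ) / n) *
      if τ ≤ k then 1 / ((n : ℝ) - τ) else -(1 / (τ : ℝ))

theorem IsCandidate.lt {m : PreChangeMean} {τ n : ℕ} (h : IsCandidate m τ n) : τ < n := by
  cases m
  · exact h
  · exact h.2

theorem sum_range_ite {τ n : ℕ} (h : τ < n) (f g : ℕ → ℝ) :
    ∑ k ∈ Finset.range n, (if τ ≤ k then f k else g k)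
      = ∑ k ∈ Finset.Ico τ n, f k + ∑ k ∈ Finset.range τ, g k := by
  rw [Finset.range_eq_Ico, ← Finset.sum_Ico_consecutive _ (Nat.zero_le τ) h.le, add_comm,
    ← Finset.range_eq_Ico]
  congr 1
  · exact Finset.sum_congr rfl fun k hk => if_pos (Finset.mem_Ico.1 hk).1
  · exact Finset.sum_congr rfl fun k hk => if_neg (by simpa using hk)

theorem sum_evidenceWeight_sq {m : PreChangeMean} {τ n : ℕ} (h : IsCandidate m τ n) :
    ∑ k ∈ Finset.range n, evidenceWeight τ n m k ^ 2 = 1 := by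
  have hlt := h.lt
  have hn : (0 : ℝ) < n - τ := sub_pos.2 (by exact_mod_cast hlt)
  have hn0 : (0 : ℝ) < n := by exact_mod_cast (Nat.zero_le τ).trans_lt hlt
  cases m with
  | known =>
    simp only [evidenceWeight, ite_pow, sum_range_ite hlt]
    rw [Finset.sum_const, Finset.sum_const, Nat.card_Ico, nsmul_eq_mul, Nat.cast_sub hlt.le,
      div_pow, Real.sq_sqrt hn.le]
    field_simp
    simp
  | unknown =>
    have hτ : (0 : ℝ) < τ := by exact_mod_cast h.1
    simp only [evidenceWeight, mul_pow, ite_pow]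
    rw [← Finset.mul_sum, sum_range_ite hlt, Finset.sum_const, Finset.sum_const, Nat.card_Ico,
      Finset.card_range, nsmul_eq_mul, nsmul_eq_mul, Nat.cast_sub hlt.le,
      Real.sq_sqrt (by positivity)]
    field_simp
    ring

theorem sum_Ioc_eq_sum_Ico_succ (f : ℕ → ℝ) (a b : ℕ) :
    ∑ t ∈ Finset.Ioc a b, f t = ∑ k ∈ Finset.Ico a b, f (k + 1) := by
  rw [Finset.sum_Ico_add' f a b 1]
  refine Finset.sum_congr ?_ fun _ _ => rfl
  ext t
  simp only [Finset.mem_Ioc, Finset.mem_Ico]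
  omega

theorem evidence_eq_weighted_sum (y : ℕ → EuclideanSpace ℝ (Fin p)) {m : PreChangeMean} {τ n : ℕ}
    (h : IsCandidate m τ n) :
    evidence y τ n m = ∑ k ∈ Finset.range n, evidenceWeight τ n m k • y (k + 1) := by
  ext i
  have hlt := h.lt
  rw [WithLp.ofLp_sum, Finset.sum_apply]
  cases m with
  | known =>
    simp only [evidence, evidenceWeight, WithLp.ofLp_smul, Pi.smul_apply, smul_eq_mul, ite_mul]
    rw [sum_range_ite hlt, sum_Ioc_eq_sum_Ico_succ (fun t => y t i), ← Finset.mul_sum]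
    simp
  | unknown =>
    simp only [evidence, evidenceWeight, WithLp.ofLp_smul, Pi.smul_apply, smul_eq_mul, mul_assoc,
      ite_mul]
    rw [← Finset.mul_sum, sum_range_ite hlt, sum_Ioc_eq_sum_Ico_succ (fun t => y t i),
      sum_Ioc_eq_sum_Ico_succ (fun t => y t i), ← Finset.mul_sum, ← Finset.mul_sum,
      Finset.range_eq_Ico]
    ring

/-! ### Union bound over times and candidates -/

/-- This is `ζ(3) ≤ 5/4`, by telescoping `1 / k³ ≤ 1 / ((k - 1) k (k + 1))` for `k ≥ 2`; the term at
`n = 0` vanishes. -/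
theorem sum_range_div_pow_four_le (N : ℕ) :
    ∑ n ∈ Finset.range N, (n : ℝ) * (1 / (n : ℝ) ^ 4) ≤ 5 / 4 := by
  -- The subtracted term is the telescoping remainder; at `N = 0` both sides equal `1`.
  have key : ∀ N : ℕ, ∑ n ∈ Finset.range (N + 2), (n : ℝ) * (1 / (n : ℝ) ^ 4)
      ≤ 5 / 4 - 1 / (2 * ((N : ℝ) + 1) * (N + 2)) := by
    intro N
    induction N with
    | zero => norm_num [Finset.sum_range_succ]
    | succ N ih =>
      rw [Finset.sum_range_succ]
      have hN : (0 : ℝ) ≤ N := N.cast_nonneg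
      have hstep : ((N + 2 : ℕ) : ℝ) * (1 / ((N + 2 : ℕ) : ℝ) ^ 4)
          ≤ 1 / (2 * (N + 1) * (N + 2)) - 1 / (2 * (N + 2) * (N + 3)) := by
        have e : (1 : ℝ) / (2 * (N + 1) * (N + 2)) - 1 / (2 * (N + 2) * (N + 3))
            = 1 / ((N + 1) * (N + 2) * (N + 3)) := by
          field_simp
          ring
        have e' : ((N + 2 : ℕ) : ℝ) * (1 / ((N + 2 : ℕ) : ℝ) ^ 4) = 1 / ((N : ℝ) + 2) ^ 3 := by
          push_cast
          field_simp
        rw [e, e']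
        refine one_div_le_one_div_of_le (by positivity) ?_
        nlinarith
      rw [show N + 1 + 1 = N + 2 from rfl]
      have e3 : (1 : ℝ) / (2 * ((N + 1 : ℕ) + 1) * ((N + 1 : ℕ) + 2))
          = 1 / (2 * (N + 2) * (N + 3)) := by
        push_cast
        ring_nf
      rw [e3]
      linarith
  refine (Finset.sum_le_sum_of_subset_of_nonneg (Finset.range_mono (by omega : N ≤ N + 2))
    fun n _ _ => by positivity).trans ((key N).trans ?_)
  have : (0 : ℝ) ≤ 1 / (2 * ((N : ℝ) + 1) * (N + 2)) := by positivity
  linarith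

theorem exp_neg_xn {α : ℝ} (hα : 0 < α) {n : ℕ} (hn : 1 ≤ n) :
    Real.exp (-xn α n) = α * (1 / (n : ℝ) ^ 4) := by
  have hn0 : (0 : ℝ) < n := by exact_mod_cast hn
  rw [xn, neg_sub, Real.exp_sub, Real.exp_log hα, show 4 * Real.log n = (4 : ℕ) * Real.log n by
    norm_num, Real.exp_nat_mul, Real.exp_log hn0, div_eq_mul_one_div]

theorem xn_pos {α : ℝ} (hα0 : 0 < α) (hα1 : α < 1) {n : ℕ} (hn : 1 ≤ n) : 0 < xn α n := by
  have h1 := Real.log_neg hα0 hα1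
  have h2 := Real.log_nonneg (show (1 : ℝ) ≤ n by exact_mod_cast hn)
  rw [xn]
  linarith

/-- The constant `4/5` is the reciprocal of the bound `5/4` on the series, so the total is exactly
`α`. -/
theorem measure_exists_candidate_le {α : ℝ} (hα : 0 < α) (m : PreChangeMean)
    (A : ℕ → ℕ → Set Ω) (hA : ∀ τ n, IsCandidate m τ n →
      P (A τ n) ≤ ENNReal.ofReal (4 / 5 * Real.exp (-xn α n))) :
    P {ω | ∃ τ n : ℕ, IsCandidate m τ n ∧ ω ∈ A τ n} ≤ ENNReal.ofReal α := by
  classical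
  have hsub : {ω | ∃ τ n : ℕ, IsCandidate m τ n ∧ ω ∈ A τ n} ⊆
      ⋃ n : ℕ, ⋃ τ ∈ (Finset.range n).filter fun τ => IsCandidate m τ n, A τ n := by
    rintro ω ⟨τ, n, h, hω⟩
    simp only [Set.mem_iUnion]
    exact ⟨n, τ, Finset.mem_filter.2 ⟨Finset.mem_range.2 h.lt, h⟩, hω⟩
  refine (measure_mono hsub).trans ((measure_iUnion_le _).trans ?_)
  have hterm : ∀ n : ℕ,
      P (⋃ τ ∈ (Finset.range n).filter fun τ => IsCandidate m τ n, A τ n)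
        ≤ ENNReal.ofReal (4 / 5 * α * (n * (1 / (n : ℝ) ^ 4))) := by
    intro n
    refine (measure_biUnion_finset_le _ _).trans ?_
    refine (Finset.sum_le_sum (g := fun _ => ENNReal.ofReal (4 / 5 * (α * (1 / (n : ℝ) ^ 4))))
      fun τ hτ => ?_).trans ?_
    · have h := (Finset.mem_filter.1 hτ).2
      rw [← exp_neg_xn hα (Nat.one_le_of_lt h.lt)]
      exact hA τ n h
    · refine (Finset.sum_le_sum_of_subset (Finset.filter_subset _ _)).trans_eq ?_
      rw [Finset.sum_const, Finset.card_range, nsmul_eq_mul, ← ENNReal.ofReal_natCast,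
        ← ENNReal.ofReal_mul (by positivity)]
      congr 1
      ring
  refine (ENNReal.tsum_le_tsum hterm).trans (ENNReal.tsum_le_of_sum_range_le fun N => ?_)
  rw [← ENNReal.ofReal_sum_of_nonneg fun n _ => by positivity, ← Finset.mul_sum]
  refine ENNReal.ofReal_le_ofReal ?_
  nlinarith [mul_le_mul_of_nonneg_left (sum_range_div_pow_four_le N) hα.le]

end FalseAlarm

/-! ### The three false-alarm bounds -/

theorem mainTheorem7 {Ω : Type*} [MeasurableSpace Ω] (P : Measure Ω) [IsProbabilityMeasure P]
    (p : ℕ) (hp : 1 ≤ p) (ε : ℕ → Ω → EuclideanSpace ℝ (Fin p))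
    (hlaw : ∀ t : ℕ, 1 ≤ t → HasLaw (ε t) (multivariateGaussian 0 1) P)
    (hindep : iIndepFun (fun t : ℕ => ε (t + 1)) P)
    (α : ℝ) (hα0 : 0 < α) (hα1 : α < 1) :
    (∀ (m : FalseAlarm.PreChangeMean) (r : FalseAlarm.Ranking),
      P {ω | ∃ τ n : ℕ, FalseAlarm.IsCandidate m τ n ∧
        FalseAlarm.rankOneThreshold p α n ≤
          FalseAlarm.rankStat r 1 (FalseAlarm.evidence (fun t => ε t ω) τ n m)} ≤
        ENNReal.ofReal α) ∧
    (∀ (m : FalseAlarm.PreChangeMean) (r : FalseAlarm.Ranking) (s : ℕ), 1 ≤ s → s ≤ p →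
      P {ω | ∃ τ n : ℕ, FalseAlarm.IsCandidate m τ n ∧
        FalseAlarm.rankThreshold p s α n ≤
          FalseAlarm.rankStat r s (FalseAlarm.evidence (fun t => ε t ω) τ n m)} ≤
        ENNReal.ofReal α) ∧
    (∀ (m : FalseAlarm.PreChangeMean) (a : ℝ), 0 ≤ a →
      P {ω | ∃ τ n : ℕ, FalseAlarm.IsCandidate m τ n ∧
        FalseAlarm.thresholdedThreshold p a α n ≤
          FalseAlarm.thresholdedStat a (FalseAlarm.evidence (fun t => ε t ω) τ n m)} ≤
        ENNReal.ofReal α) := by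

  have hX : ∀ (m : FalseAlarm.PreChangeMean) (τ n : ℕ), FalseAlarm.IsCandidate m τ n →
      HasLaw (fun ω => ∑ k ∈ Finset.range n, FalseAlarm.evidenceWeight τ n m k • ε (k + 1) ω)
        (stdGaussian (EuclideanSpace ℝ (Fin p))) P := fun m τ n h =>
    FalseAlarm.hasLaw_weighted_sum hlaw hindep n _ (FalseAlarm.sum_evidenceWeight_sq h)
  refine ⟨fun m r => ?_, fun m r s hs hsp => ?_, fun m a ha => ?_⟩
  · refine FalseAlarm.measure_exists_candidate_le hα0 m (fun τ n => {ω |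
      FalseAlarm.rankOneThreshold p α n ≤
        FalseAlarm.rankStat r 1 (FalseAlarm.evidence (fun t => ε t ω) τ n m)}) fun τ n h => ?_
    simp_rw [FalseAlarm.evidence_eq_weighted_sum _ h]
    have hx := FalseAlarm.xn_pos hα0 hα1 (Nat.one_le_of_lt h.lt)
    have hp0 : (1 : ℝ) ≤ p := by exact_mod_cast hp
    have hlog : 0 ≤ Real.log (2 * p) := Real.log_nonneg (by linarith)
    refine (FalseAlarm.measure_rankStat_ge_le _ r hp
      (b := Real.exp (-(FalseAlarm.xn α n + Real.log (2 * p)))) fun I hI => ?_).trans ?_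
    · rw [FalseAlarm.rankOneThreshold, ← mul_add]
      exact FalseAlarm.measure_sum_sq_ge_one_le (hX m τ n h) hI (by positivity)
    · refine ENNReal.ofReal_le_ofReal ?_
      rw [Nat.choose_one_right, neg_add, Real.exp_add, Real.exp_neg (Real.log _),
        Real.exp_log (by positivity)]
      have hE := Real.exp_pos (-FalseAlarm.xn α n)
      -- The one-coordinate tail is already two-sided without a factor two, so the `2` in `log (2p)`
      -- is spare and yields `1/2 ≤ 4/5`.
      have : (p : ℝ) * (Real.exp (-FalseAlarm.xn α n) * (2 * (p : ℝ))⁻¹)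
          = 1 / 2 * Real.exp (-FalseAlarm.xn α n) := by
        field_simp
      rw [this]
      linarith
  · refine FalseAlarm.measure_exists_candidate_le hα0 m (fun τ n => {ω |
      FalseAlarm.rankThreshold p s α n ≤
        FalseAlarm.rankStat r s (FalseAlarm.evidence (fun t => ε t ω) τ n m)}) fun τ n h => ?_
    simp_rw [FalseAlarm.evidence_eq_weighted_sum _ h]
    have hx := FalseAlarm.xn_pos hα0 hα1 (Nat.one_le_of_lt h.lt)
    have hc : (1 : ℝ) ≤ p.choose s := by exact_mod_cast Nat.choose_pos hsp
    have hlog : 0 ≤ Real.log (p.choose s) := Real.log_nonneg hc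
    refine (FalseAlarm.measure_rankStat_ge_le _ r hsp
      (b := 4 / 5 * Real.exp (-(FalseAlarm.xn α n + Real.log (p.choose s))))
      fun I hI => ?_).trans ?_
    · exact FalseAlarm.measure_sum_sq_ge_rank_le (hX m τ n h) hs hI (by positivity)
    · refine ENNReal.ofReal_le_ofReal (le_of_eq ?_)
      rw [neg_add, Real.exp_add, Real.exp_neg (Real.log _), Real.exp_log (by positivity)]
      field_simp
  · refine FalseAlarm.measure_exists_candidate_le hα0 m (fun τ n => {ω |
      FalseAlarm.thresholdedThreshold p a α n ≤
        FalseAlarm.thresholdedStat a (FalseAlarm.evidence (fun t => ε t ω) τ n m)})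
      fun τ n h => ?_
    simp_rw [FalseAlarm.evidence_eq_weighted_sum _ h]
    exact FalseAlarm.measure_thresholdedStat_ge_le (hX m τ n h) ha
      (FalseAlarm.xn_pos hα0 hα1 (Nat.one_le_of_lt h.lt))
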